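/- **Transformation from NLS rogue waves to KPI lumps.** Throughout, $x,y,t$ are real, $N\ge 1$ is an integer and $a_1,a_3,\dots,a_{2N-1}$ are arbitrary complex constants; put $\boldsymbol a=(a_1,0,a_3,0,\dots,a_{2N-1})$ (extended by zeros). *Definitions.* The elementary Schur polynomials $S_j(\boldsymbol v)$, $\boldsymbol v=(v_1,v_2,\dots)$, are defined by $\sum_{j\ge0}S_j(\boldsymbol v)\epsilon^j=\exp\big(\sum_{i\ge1}v_i\epsilon^i\big)$, and $\boldsymbol s=(s_1,s_2,\dots)$ by $\sum_{j\ge1}s_j\lambda^j=\ln\big[\tfrac2\lambda\tanh\tfrac\lambda2\big]$. For two vectors $\boldsymbol p,\boldsymbol q$ let $$\Delta_N(\boldsymbol p,\boldsymbol q)=\det_{1\le i,j\le N}\big(\phi_{2i-1,2j-1}\big),\qquad \phi_{i,j}=\sum_{\nu=0}^{\min(i,j)}\frac1{4^\nu}\,S_{i-\nu}(\boldsymbol p+\nu\boldsymbol s)\,S_{j-\nu}(\boldsymbol q+\nu\boldsymbol s).$$ *NLS.* For $n\in\{0,1\}$ let $\boldsymbol x^{\pm}(n)=(x_1^\pm,0,x_3^\pm,0,\dots)$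 with $x_1^\pm=x\pm \mathrm i t\pm n$ and $x_{2j+1}^\pm=\dfrac{x\pm 2^{2j}\,\mathrm i t}{(2j+1)!}$ for $j\ge1$. Put $$\sigma_n=\sigma_n(x,t;a_1,a_3,\dots,a_{2N-1})=\Delta_N\big(\boldsymbol x^+(n)+\boldsymbol a,\ \boldsymbol x^-(n)+\boldsymbol a^*\big),\qquad u_N^{[NLS]}=\frac{\sigma_1}{\sigma_0}\,e^{\mathrm i t}.$$ *KPI.* Let $\boldsymbol x^+=(x_1^+,0,x_3^+,0,\dots)$ with $x_{2j-1}^+=\dfrac{x+2^{2j-1}\mathrm i y-3^{2j-1}(4t)}{(2j-1)!}$ for $j\ge1$. Put $$\sigma^{[KP]}=\sigma^{[KP]}(x,y,t;a_1,a_3,\dots,a_{2N-1})=\Delta_N\big(\boldsymbol x^++\boldsymbol a,\ (\boldsymbol x^+)^*+\boldsymbol a^*\big),\qquad u_N^{[KP]}=2\,\partial_x^2\ln\sigma^{[KP]}.$$ *Claim.* For all $N\ge1$, all complex $a_1,a_3,\dots,a_{2N-1}$ and all real $x,y,t$: 1. $\sigma_0$ is smooth in $x$ and the bilinear identity $(D_x^2+2)\,\sigma_0\cdot\sigma_0=2|\sigma_1|^2$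 holds at $(x,t)$, where $D_x^m f\cdot g=(\partial_x-\partial_{x'})^m f(x)g(x')\big|_{x'=x}$ is Hirota's operator. 2. $\sigma_0$ and $\sigma^{[KP]}$ are real and strictly positive, and $\ln\sigma^{[KP]}$ is smooth in $x$ (so $u_N^{[NLS]}$ and $u_N^{[KP]}$ are well defined everywhere). 3. With $\tilde a_{2j-1}=a_{2j-1}-\dfrac{3^{2j-1}(4t)}{(2j-1)!}$, $1\le j\le N$, $$\sigma^{[KP]}(x,y,t;a_1,a_3,\dots,a_{2N-1})=\sigma_0(x,2y;\tilde a_1,\tilde a_3,\dots,\tilde a_{2N-1}).$$ 4. With the same $\tilde a_{2j-1}$, $$u_N^{[KP]}(x,y,t;a_1,a_3,\dots,a_{2N-1})=2\Big(\big|u_N^{[NLS]}(x,2y;\tilde a_1,\tilde a_3,\dots,\tilde a_{2N-1})\big|^2-1\Big).$$ -/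

import Mathlib

open scoped ContDiff

namespace RogueLump

noncomputable section

/-- The elementary Schur polynomial `S_j(x)`, the coefficient of `ε ^ j` in
`exp (∑_{i ≥ 1} x_i ε ^ i)`. The entry `v i` is `x_i` for `i ≥ 1`; `v 0` is not used. -/
def schur (j : ℕ) (v : ℕ → ℂ) : ℂ :=
  PowerSeries.coeff j
    ((PowerSeries.exp ℂ).subst (PowerSeries.mk fun i => if i = 0 then 0 else v i))

/-- The power series of `tanh (l / 2) = (e ^ (l/2) - e ^ (-l/2)) / (e ^ (l/2) + e ^ (-l/2))`
in the variable `l`. -/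
def tanhHalf : PowerSeries ℝ :=
  (PowerSeries.rescale (1 / 2) (PowerSeries.exp ℝ)
      - PowerSeries.rescale (-1 / 2) (PowerSeries.exp ℝ))
    * (PowerSeries.rescale (1 / 2) (PowerSeries.exp ℝ)
      + PowerSeries.rescale (-1 / 2) (PowerSeries.exp ℝ))⁻¹

/-- The power series of `(2 / l) tanh (l / 2)`. It has constant term `1`. -/
def twoDivTanhHalf : PowerSeries ℝ :=
  PowerSeries.mk fun n => 2 * PowerSeries.coeff (n + 1) tanhHalf

/-- The vector `s`: `∑_{j ≥ 1} s_j l ^ j = ln ((2 / l) tanh (l / 2))`. -/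
def sCoeff (j : ℕ) : ℝ :=
  PowerSeries.coeff j (PowerSeries.logOf twoDivTanhHalf)

/-- The vector `(a_1, 0, a_3, 0, …, a_{2N-1}, 0, 0, …)`, where `a j` is the parameter
`a_{2j+1}`, `0 ≤ j < N`. -/
def paramVec {N : ℕ} (a : Fin N → ℂ) (k : ℕ) : ℂ :=
  if h : k % 2 = 1 ∧ k / 2 < N then a ⟨k / 2, h.2⟩ else 0

/-- The bilinear sum
`∑_{ν = 0}^{min (i, j)} 4 ^ (-ν) S_{i-ν} (p + ν s) S_{j-ν} (q + ν s)`. -/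
def entry (p q : ℕ → ℂ) (i j : ℕ) : ℂ :=
  ∑ ν ∈ Finset.range (min i j + 1), (1 / 4 ^ ν : ℂ)
    * schur (i - ν) (fun k => p k + (ν : ℂ) * (sCoeff k : ℂ))
    * schur (j - ν) (fun k => q k + (ν : ℂ) * (sCoeff k : ℂ))

/-- `det_{1 ≤ i, j ≤ N} (φ_{2i-1, 2j-1})` for `φ = entry p q`. -/
def oddDet (N : ℕ) (p q : ℕ → ℂ) : ℂ :=
  Matrix.det (Matrix.of fun i j : Fin N => entry p q (2 * (i : ℕ) + 1) (2 * (j : ℕ) + 1))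

/-- The NLS vectors `x⁺(n)` (for `e = 1`) and `x⁻(n)` (for `e = -1`):
`x_1 = x + e i t + e n`, `x_k = (x + e 2 ^ (k-1) i t) / k!` for odd `k ≥ 3`,
and `x_k = 0` for even `k`. -/
def nlsVec (e : ℂ) (n : ℤ) (x t : ℝ) (k : ℕ) : ℂ :=
  if k % 2 = 0 then 0
  else if k = 1 then (x : ℂ) + e * (Complex.I * t) + e * n
  else ((x : ℂ) + e * (2 ^ (k - 1) * (Complex.I * t))) / (k.factorial : ℂ)

/-- The NLS determinant `σ_n (x, t; a_1, a_3, …, a_{2N-1})`. -/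
def sigmaNLS (N : ℕ) (n : ℤ) (a : Fin N → ℂ) (x t : ℝ) : ℂ :=
  oddDet N (fun k => nlsVec 1 n x t k + paramVec a k)
    (fun k => nlsVec (-1) n x t k + (starRingEnd ℂ) (paramVec a k))

/-- The NLS rogue wave `u_N = (σ_1 / σ_0) e ^ (i t)`. -/
def uNLS (N : ℕ) (a : Fin N → ℂ) (x t : ℝ) : ℂ :=
  sigmaNLS N 1 a x t / sigmaNLS N 0 a x t * Complex.exp (Complex.I * t)

/-- The KPI vector `x⁺`: `x_k = (x + 2 ^ k i y - 3 ^ k (4 t)) / k!` for odd `k`, and `0` for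
even `k`. -/
def kpVec (x y t : ℝ) (k : ℕ) : ℂ :=
  if k % 2 = 0 then 0
  else ((x : ℂ) + 2 ^ k * (Complex.I * y) - 3 ^ k * (4 * t)) / (k.factorial : ℂ)

/-- The KPI determinant `σ (x, y, t; a_1, a_3, …, a_{2N-1})`. -/
def sigmaKP (N : ℕ) (a : Fin N → ℂ) (x y t : ℝ) : ℂ :=
  oddDet N (fun k => kpVec x y t k + paramVec a k)
    (fun k => (starRingEnd ℂ) (kpVec x y t k) + (starRingEnd ℂ) (paramVec a k))

/-- The KPI higher-order lump `u_N = 2 ∂_x² ln σ`. -/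
def uKP (N : ℕ) (a : Fin N → ℂ) (x y t : ℝ) : ℂ :=
  2 * iteratedDeriv 2 (fun ξ : ℝ => Complex.log (sigmaKP N a ξ y t)) x

/-- The parameter substitution `a_{2j-1} → a_{2j-1} - 3 ^ (2j-1) (4 t) / (2j-1)!`. -/
def shiftParam {N : ℕ} (a : Fin N → ℂ) (t : ℝ) : Fin N → ℂ := fun j =>
  a j - 3 ^ (2 * (j : ℕ) + 1) * (4 * (t : ℂ)) / ((2 * (j : ℕ) + 1).factorial : ℂ)

/-- The operator `∂_x - ∂_x'` on functions of `(x, x')`. -/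
def hirotaOp (F : ℝ → ℝ → ℂ) : ℝ → ℝ → ℂ := fun x x' =>
  deriv (fun ξ => F ξ x') x - deriv (fun ξ => F x ξ) x'

/-- Hirota's bilinear operator: `D_x ^ m f · g (x)` is `(∂_x - ∂_x') ^ m (f (x) g (x'))` at
`x' = x`. -/
def hirotaD (m : ℕ) (f g : ℝ → ℂ) (x : ℝ) : ℂ :=
  (hirotaOp^[m] fun ξ ξ' => f ξ * g ξ') x x

end

end RogueLump

/-!
Write `p = e ^ X`. The generating series of `S_j (v + ν s)` is `exp (∑ v_k X ^ k) T ^ ν` with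
`T = (2 / X) tanh (X / 2)`, so the entries `φ_{ij}` are the coefficients of the two-variable series
`P(X) Q(Y) / (1 - tanh (X / 2) tanh (Y / 2))`, where `P` and `Q` are the exponential series of the
two vectors (`entry_eq_bil`). By the addition theorem for `tanh` the kernel is
`(p + 1) (q + 1) / (2 (p + q))` with `q = e ^ Y`. Multiplication by `p + q`, or by
`p⁻¹ + q⁻¹ = (p + q) / (p q)`, therefore turns the matrix `M` of the `φ_{ij}` into a matrix of rank
one (`bil_exp_mul_add`, `oddMat_expNeg_mul_add`): `u vᵀ` and `a bᵀ`, say.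

The derivative in `x` is multiplication by `sinh X + sinh Y`. As `2 cosh X = p + p⁻¹` is even, it
acts on the coefficients of odd degree by a constant matrix `L`, whence
`L M + M Lᵀ = u vᵀ + a bᵀ` (`coshMat_mul_oddMat_add`) and `M' = (L M + M Lᵀ) / 2 - a bᵀ`. Jacobi's
formula gives `(ln det M)' = vᵀ M⁻¹ u - tr L` (`hasDerivAt_det_of_rank_one`), and a second
differentiation gives `(ln det M)'' + 1 = (1 - vᵀ M⁻¹ a) (1 - bᵀ M⁻¹ u)`
(`hasDerivAt_dotProduct_inv_mulVec`). Passing from `n = 0` to `n = ± 1` multiplies the generating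
series by `(p / q) ^ (± 1)`, so `σ_{±1}` are the determinants of `u bᵀ - M` and `a vᵀ - M`, and the
two factors are `(-1) ^ N σ_{∓1} / σ_0`. Since `σ_{-1}` is the conjugate of `σ_1`, this is
`(ln σ_0)'' + 1 = |σ_1 / σ_0|²` (`hasDerivAt_logDerivTau`), which is both the bilinear identity and
the transformation of the solutions.

That `M` is invertible comes from positivity: for conjugate vectors `M = W Wᴴ`, where `W` contains a
triangular matrix with nonzero diagonal entries (`det_oddMat_conj_pos`). Finally, the KPI vector and
the NLS vector with shifted parameters agree in the entries of index at most `2N - 1`, and only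
these enter the determinant (`sigmaKP_eq_sigmaNLS`).
-/

namespace RogueLump

noncomputable section

open PowerSeries Finset

/-! ### Generating series of the elementary Schur polynomials -/

/-- The series `∑_{i ≥ 1} v_i X ^ i`. -/
def expArg (v : ℕ → ℂ) : PowerSeries ℂ := PowerSeries.mk fun i => if i = 0 then 0 else v i

/-- The generating series `exp (∑_{i ≥ 1} v_i X ^ i)` of the Schur polynomials. -/
def schurSeries (v : ℕ → ℂ) : PowerSeries ℂ := (PowerSeries.exp ℂ).subst (expArg v)

lemma schur_eq_coeff (j : ℕ) (v : ℕ → ℂ) : schur j v = coeff j (schurSeries v) := rfl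

/-- A series with vanishing constant coefficient may be substituted into `exp`, and the result
has constant coefficient `1`. -/
lemma constantCoeff_exp_subst {K : Type*} [Field K] [CharZero K] {V : PowerSeries K}
    (hV : constantCoeff V = 0) : constantCoeff ((PowerSeries.exp K).subst V) = 1 := by
  have hs : HasSubst V := HasSubst.of_constantCoeff_zero' hV
  rw [← coeff_zero_eq_constantCoeff_apply, coeff_subst' hs, finsum_eq_single _ 0]
  · simp
  · intro n hn
    simp [hV, hn]

lemma derivative_exp_subst {K : Type*} [Field K] [CharZero K] {V : PowerSeries K}
    (hV : constantCoeff V = 0) :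
    derivative K ((PowerSeries.exp K).subst V)
      = (PowerSeries.exp K).subst V * derivative K V := by
  rw [derivative_subst (HasSubst.of_constantCoeff_zero' hV), derivative_exp]

/-- A power series over a field of characteristic zero is determined by its constant coefficient
and its logarithmic derivative. -/
lemma eq_of_derivative_eq_mul {K : Type*} [Field K] [CharZero K] {f g D : PowerSeries K}
    (hf : derivative K f = f * D) (hg : derivative K g = g * D)
    (h0 : constantCoeff f = constantCoeff g) : f = g := by
  ext n
  induction n using Nat.strong_induction_on with
  | _ n ih =>
    cases n with
    | zero => simpa using h0
    | succ n =>
      have e1 := congrArg (coeff n) hf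
      have e2 := congrArg (coeff n) hg
      rw [coeff_derivative, coeff_mul] at e1 e2
      have : ∑ p ∈ antidiagonal n, coeff p.1 f * coeff p.2 D
          = ∑ p ∈ antidiagonal n, coeff p.1 g * coeff p.2 D := by
        refine Finset.sum_congr rfl fun p hp => ?_
        rw [ih p.1 (by have := mem_antidiagonal.1 hp; omega)]
      have hn : (n + 1 : K) ≠ 0 := by exact_mod_cast n.succ_ne_zero
      exact mul_right_cancel₀ hn (e1.trans (this.trans e2.symm))

lemma constantCoeff_expArg (v : ℕ → ℂ) : constantCoeff (expArg v) = 0 := by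
  simp [expArg, ← coeff_zero_eq_constantCoeff_apply]

lemma constantCoeff_schurSeries (v : ℕ → ℂ) : constantCoeff (schurSeries v) = 1 :=
  constantCoeff_exp_subst (constantCoeff_expArg v)

lemma derivative_schurSeries (v : ℕ → ℂ) :
    derivative ℂ (schurSeries v) = schurSeries v * derivative ℂ (expArg v) :=
  derivative_exp_subst (constantCoeff_expArg v)

lemma expArg_add (v w : ℕ → ℂ) : expArg (fun k => v k + w k) = expArg v + expArg w := by
  ext n
  by_cases h : n = 0 <;> simp [expArg, h]

lemma schurSeries_add (v w : ℕ → ℂ) :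
    schurSeries (fun k => v k + w k) = schurSeries v * schurSeries w := by
  refine eq_of_derivative_eq_mul (derivative_schurSeries _) ?_ ?_
  · rw [Derivation.leibniz, derivative_schurSeries, derivative_schurSeries, expArg_add, map_add]
    simp only [smul_eq_mul]
    ring
  · simp [constantCoeff_schurSeries]

lemma schurSeries_zero : schurSeries (fun _ => 0) = 1 := by
  refine eq_of_derivative_eq_mul (derivative_schurSeries _) ?_ ?_
  · have : expArg (fun _ => 0) = 0 := by ext; simp [expArg]
    simp [this]
  · simp [constantCoeff_schurSeries]

lemma schurSeries_natCast_mul (n : ℕ) (v : ℕ → ℂ) :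
    schurSeries (fun k => (n : ℂ) * v k) = schurSeries v ^ n := by
  induction n with
  | zero => simpa using schurSeries_zero
  | succ n ih =>
    rw [pow_succ, ← ih, ← schurSeries_add]
    congr 1
    ext k
    push_cast
    ring

/-- The recursion `(n + 1) S_{n+1} = ∑_{i + k = n} S_i (k + 1) v_{k+1}`. -/
lemma coeff_succ_schurSeries (v : ℕ → ℂ) (n : ℕ) :
    coeff (n + 1) (schurSeries v)
      = (∑ p ∈ antidiagonal n, coeff p.1 (schurSeries v) * (v (p.2 + 1) * (p.2 + 1)))
        / (n + 1) := by
  have hn : (n + 1 : ℂ) ≠ 0 := by exact_mod_cast n.succ_ne_zero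
  have e1 := congrArg (coeff n) (derivative_schurSeries v)
  rw [coeff_derivative, coeff_mul] at e1
  rw [eq_div_iff hn, e1]
  refine Finset.sum_congr rfl fun p _ => ?_
  rw [coeff_derivative]
  simp [expArg]

/-- `S_j (v)` depends only on `v_1, …, v_j`. -/
lemma schur_congr {j : ℕ} {v w : ℕ → ℂ} (h : ∀ k, 1 ≤ k → k ≤ j → v k = w k) :
    schur j v = schur j w := by
  simp only [schur_eq_coeff]
  induction j using Nat.strong_induction_on with
  | _ j ih =>
    cases j with
    | zero => simp [constantCoeff_schurSeries]
    | succ j =>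
      rw [coeff_succ_schurSeries, coeff_succ_schurSeries]
      refine congrArg (fun z : ℂ => z / ((j : ℂ) + 1)) (Finset.sum_congr rfl fun p hp => ?_)
      have hp := mem_antidiagonal.1 hp
      rw [ih p.1 (by omega) fun k h1 h2 => h k h1 (by omega), h (p.2 + 1) (by omega) (by omega)]

lemma map_conj_schurSeries (v : ℕ → ℂ) :
    map (starRingEnd ℂ) (schurSeries v) = schurSeries fun k => starRingEnd ℂ (v k) := by
  ext n
  rw [coeff_map]
  induction n using Nat.strong_induction_on with
  | _ n ih =>
    cases n with
    | zero => simp [constantCoeff_schurSeries]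
    | succ n =>
      rw [coeff_succ_schurSeries, coeff_succ_schurSeries, map_div₀, map_sum]
      simp only [map_add, map_natCast, map_one, map_mul]
      refine congrArg (fun z : ℂ => z / ((n : ℂ) + 1)) (Finset.sum_congr rfl fun p hp => ?_)
      have hp := mem_antidiagonal.1 hp
      rw [ih p.1 (by omega)]

/-! ### The exponential series and `tanh` -/

/-- The series of `e ^ (-X)`. -/
def expNeg : PowerSeries ℂ := rescale (-1 : ℂ) (PowerSeries.exp ℂ)

lemma exp_mul_expNeg : PowerSeries.exp ℂ * expNeg = 1 := exp_mul_exp_neg_eq_one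

lemma schurSeries_single_one :
    schurSeries (fun k => if k = 1 then 1 else 0) = PowerSeries.exp ℂ := by
  have : expArg (fun k => if k = 1 then 1 else 0) = X := by
    ext n
    rw [coeff_X]
    by_cases h : n = 0 <;> simp [expArg, h]
  rw [schurSeries, this, X_subst]

lemma schurSeries_single_neg_one :
    schurSeries (fun k => if k = 1 then -1 else 0) = expNeg := by
  have h : schurSeries (fun k => if k = 1 then -1 else 0) * PowerSeries.exp ℂ = 1 := by
    rw [← schurSeries_single_one, ← schurSeries_add, ← schurSeries_zero]
    congr 1
    ext k
    by_cases h : k = 1 <;> simp [h]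
  calc _ = schurSeries (fun k => if k = 1 then -1 else 0) * (PowerSeries.exp ℂ * expNeg) := by
        rw [exp_mul_expNeg, mul_one]
    _ = _ := by rw [← mul_assoc, h, one_mul]

lemma coeff_exp_complex (n : ℕ) : coeff n (PowerSeries.exp ℂ) = 1 / (n.factorial : ℂ) := by
  rw [coeff_exp]; simp

lemma coeff_expNeg (n : ℕ) : coeff n expNeg = (-1) ^ n / (n.factorial : ℂ) := by
  rw [expNeg, coeff_rescale, coeff_exp_complex]; ring

/-- The vector of Taylor coefficients of `sinh`, the which is the coefficient of `x` in both
vectors `x^±`. -/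
def sinhVec (k : ℕ) : ℂ := if k % 2 = 0 then 0 else 1 / (k.factorial : ℂ)

lemma expArg_sinhVec :
    expArg sinhVec = C (1 / 2 : ℂ) * (PowerSeries.exp ℂ + expNeg) - expNeg := by
  ext n
  rw [map_sub, coeff_C_mul, map_add, coeff_exp_complex, coeff_expNeg]
  rcases Nat.even_or_odd n with h | h
  · have h2 : n % 2 = 0 := Nat.even_iff.1 h
    simp [expArg, sinhVec, h2, h.neg_one_pow]
    ring
  · have h2 : n % 2 = 1 := Nat.odd_iff.1 h
    have h3 : n ≠ 0 := by rintro rfl; simp at h2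
    simp [expArg, sinhVec, h2, h3, h.neg_one_pow]
    ring

lemma coeff_exp_add_expNeg_of_odd {n : ℕ} (h : n % 2 = 1) :
    coeff n (PowerSeries.exp ℂ + expNeg) = 0 := by
  rw [map_add, coeff_exp_complex, coeff_expNeg, (Nat.odd_iff.2 h).neg_one_pow]
  ring

/-- The complex series of `tanh (X / 2)`. -/
def tanhSeries : PowerSeries ℂ := map Complex.ofRealHom tanhHalf

lemma constantCoeff_rescale_exp (r : ℝ) :
    constantCoeff (rescale r (PowerSeries.exp ℝ)) = 1 := by
  rw [← coeff_zero_eq_constantCoeff_apply, coeff_rescale]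
  simp

/-- `tanh (X / 2) = (e ^ X - 1) / (e ^ X + 1)`. -/
lemma tanhSeries_mul : tanhSeries * (PowerSeries.exp ℂ + 1) = PowerSeries.exp ℂ - 1 := by
  have hR : tanhHalf * (PowerSeries.exp ℝ + 1) = PowerSeries.exp ℝ - 1 := by
    set a := rescale (1 / 2 : ℝ) (PowerSeries.exp ℝ) with ha
    set b := rescale (-1 / 2 : ℝ) (PowerSeries.exp ℝ) with hb
    have haa : a * a = PowerSeries.exp ℝ := by
      rw [ha, exp_mul_exp_eq_exp_add]; norm_num
    have hab : a * b = 1 := by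
      rw [ha, hb, exp_mul_exp_eq_exp_add]; norm_num
    have hinv : (a + b)⁻¹ * (a + b) = 1 := by
      refine PowerSeries.inv_mul_cancel _ ?_
      rw [ha, hb, map_add, constantCoeff_rescale_exp, constantCoeff_rescale_exp]; norm_num
    have e1 : PowerSeries.exp ℝ + 1 = (a + b) * a := by rw [← haa, ← hab]; ring
    rw [e1, show tanhHalf = (a - b) * (a + b)⁻¹ from rfl]
    calc (a - b) * (a + b)⁻¹ * ((a + b) * a) = (a - b) * a * ((a + b)⁻¹ * (a + b)) := by ring
      _ = a * a - a * b := by rw [hinv]; ring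
      _ = _ := by rw [hab, haa]
  have := congrArg (map Complex.ofRealHom) hR
  simpa only [tanhSeries, map_mul, map_add, map_sub, map_one, map_exp] using this

lemma constantCoeff_tanhHalf : constantCoeff tanhHalf = 0 := by
  rw [tanhHalf, map_mul, map_sub, constantCoeff_rescale_exp, constantCoeff_rescale_exp, sub_self,
    zero_mul]

lemma X_mul_twoDivTanhHalf : X * twoDivTanhHalf = C 2 * tanhHalf := by
  ext n
  cases n with
  | zero => simp [constantCoeff_tanhHalf]
  | succ n => rw [coeff_succ_X_mul, coeff_C_mul, twoDivTanhHalf, coeff_mk]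

lemma constantCoeff_twoDivTanhHalf : constantCoeff twoDivTanhHalf = 1 := by
  rw [← coeff_zero_eq_constantCoeff_apply, twoDivTanhHalf, coeff_mk]
  have h := congrArg (coeff 1) tanhSeries_mul
  have h0 : constantCoeff tanhSeries = 0 := by
    rw [← coeff_zero_eq_constantCoeff_apply, tanhSeries, coeff_map,
      coeff_zero_eq_constantCoeff_apply, constantCoeff_tanhHalf, map_zero]
  rw [coeff_mul, Finset.Nat.antidiagonal_succ] at h
  simp [h0, coeff_one] at h
  rw [tanhSeries, coeff_map] at h
  have h2 : ((2 * coeff 1 tanhHalf : ℝ) : ℂ) = 1 := by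
    push_cast
    simp only [Complex.ofRealHom_eq_coe] at h
    linear_combination h
  exact_mod_cast h2

/-- `exp` undoes `log` on power series with constant coefficient `1`. -/
lemma exp_subst_logOf {K : Type*} [Field K] [CharZero K] {f : PowerSeries K}
    (hf : constantCoeff f = 1) : (PowerSeries.exp K).subst (logOf f) = f := by
  have h0 := constantCoeff_logOf hf
  refine eq_of_derivative_eq_mul (derivative_exp_subst h0) ?_ ?_
  · have hs : HasSubst (f - 1) := HasSubst.of_constantCoeff_zero' (by simp [hf])
    have hgeo : derivative K (PowerSeries.log K) * (1 + X) = 1 := by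
      rw [deriv_log]
      ext n
      cases n with
      | zero => rw [mul_add, mul_one, map_add, coeff_zero_mul_X, coeff_mk]; simp
      | succ n =>
        rw [mul_add, mul_one, map_add, coeff_succ_mul_X, coeff_mk, coeff_mk, coeff_one]
        simp [pow_succ]
    have h2 : (derivative K (PowerSeries.log K)).subst (f - 1) * f = 1 := by
      have := congrArg (subst (f - 1)) hgeo
      rw [subst_mul hs, subst_add hs, subst_X hs] at this
      have h1 : (1 : PowerSeries K).subst (f - 1) = (1 : PowerSeries K) := by
        rw [← coe_substAlgHom hs, map_one]
      rw [h1] at this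
      simpa using this
    rw [logOf_eq, derivative_subst hs]
    calc _ = derivative K f := rfl
      _ = ((derivative K (PowerSeries.log K)).subst (f - 1) * f) * derivative K (f - 1) := by
          rw [h2]; simp
      _ = _ := by ring
  · rw [constantCoeff_exp_subst h0, hf]

lemma schurSeries_sCoeff :
    schurSeries (fun k => (sCoeff k : ℂ)) = map Complex.ofRealHom twoDivTanhHalf := by
  have h0 := constantCoeff_logOf constantCoeff_twoDivTanhHalf
  conv_rhs => rw [← exp_subst_logOf constantCoeff_twoDivTanhHalf]
  have harg : expArg (fun k => (sCoeff k : ℂ))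
      = map Complex.ofRealHom (logOf twoDivTanhHalf) := by
    ext n
    rw [coeff_map, expArg, coeff_mk]
    split_ifs with h
    · rw [h, coeff_zero_eq_constantCoeff_apply, h0, map_zero]
    · rfl
  refine eq_of_derivative_eq_mul (derivative_schurSeries _) ?_ ?_
  · have hder : ∀ f : PowerSeries ℝ,
        derivative ℂ (map Complex.ofRealHom f) = map Complex.ofRealHom (derivative ℝ f) := by
      intro f
      ext n
      simp [coeff_derivative]
    rw [hder, derivative_exp_subst h0, map_mul, harg, hder]
  · rw [constantCoeff_schurSeries, ← coeff_zero_eq_constantCoeff_apply, coeff_map,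
      coeff_zero_eq_constantCoeff_apply, constantCoeff_exp_subst h0, map_one]

lemma X_mul_schurSeries_sCoeff :
    X * schurSeries (fun k => (sCoeff k : ℂ)) = C 2 * tanhSeries := by
  have := congrArg (map Complex.ofRealHom) X_mul_twoDivTanhHalf
  rw [map_mul, map_mul, map_X, map_C] at this
  rw [schurSeries_sCoeff, this, tanhSeries]
  simp

/-- The shifted Schur polynomial `2 ^ (-ν) S_{i-ν} (p + ν s)` is the coefficient of `X ^ i` in
`exp (∑ p_k X ^ k) tanh (X / 2) ^ ν`. -/
lemma coeff_schurSeries_mul_tanhSeries_pow (p : ℕ → ℂ) {i ν : ℕ} (h : ν ≤ i) :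
    coeff i (schurSeries p * tanhSeries ^ ν)
      = 1 / 2 ^ ν * schur (i - ν) (fun k => p k + (ν : ℂ) * (sCoeff k : ℂ)) := by
  rw [schur_eq_coeff, schurSeries_add, schurSeries_natCast_mul]
  obtain ⟨m, rfl⟩ := Nat.exists_eq_add_of_le' h
  rw [Nat.add_sub_cancel]
  have e : schurSeries p * tanhSeries ^ ν = C (1 / 2 ^ ν : ℂ)
      * (X ^ ν * (schurSeries p * schurSeries (fun k => (sCoeff k : ℂ)) ^ ν)) := by
    have h1 : X ^ ν * schurSeries (fun k => (sCoeff k : ℂ)) ^ ν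
        = C (2 ^ ν : ℂ) * tanhSeries ^ ν := by
      rw [← mul_pow, X_mul_schurSeries_sCoeff, mul_pow, map_pow]
    have h2 : C (1 / 2 ^ ν : ℂ) * C (2 ^ ν : ℂ) = 1 := by
      rw [← map_mul]; simp
    calc _ = (C (1 / 2 ^ ν : ℂ) * C (2 ^ ν : ℂ)) * (schurSeries p * tanhSeries ^ ν) := by
          rw [h2, one_mul]
      _ = C (1 / 2 ^ ν : ℂ) * (schurSeries p * (C (2 ^ ν : ℂ) * tanhSeries ^ ν)) := by ring
      _ = _ := by rw [← h1]; ring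
  rw [e, coeff_C_mul, coeff_X_pow_mul]

lemma coeff_mul_tanhSeries_pow_of_lt (F : PowerSeries ℂ) {i ν : ℕ} (h : i < ν) :
    coeff i (F * tanhSeries ^ ν) = 0 := by
  have hX : X ∣ tanhSeries := by
    rw [X_dvd_iff, ← coeff_zero_eq_constantCoeff_apply, tanhSeries, coeff_map,
      coeff_zero_eq_constantCoeff_apply, constantCoeff_tanhHalf, map_zero]
  obtain ⟨G, hG⟩ := pow_dvd_pow_of_dvd hX ν
  rw [hG, mul_left_comm, coeff_X_pow_mul', if_neg (by omega)]

/-! ### The bilinear sum as a bilinear form on power series -/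

/-- The coefficient of `X ^ i Y ^ j` in `F(X) G(Y) / (1 - tanh (X / 2) tanh (Y / 2))`, written as
the finite sum obtained by expanding the geometric series. -/
def bil (F G : PowerSeries ℂ) (i j : ℕ) : ℂ :=
  ∑ ν ∈ range (min i j + 1), coeff i (F * tanhSeries ^ ν) * coeff j (G * tanhSeries ^ ν)

lemma entry_eq_bil (p q : ℕ → ℂ) (i j : ℕ) :
    entry p q i j = bil (schurSeries p) (schurSeries q) i j := by
  refine Finset.sum_congr rfl fun ν hν => ?_
  have hν := mem_range.1 hν
  rw [coeff_schurSeries_mul_tanhSeries_pow p (by omega),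
    coeff_schurSeries_mul_tanhSeries_pow q (by omega)]
  have : (4 : ℂ) ^ ν = 2 ^ ν * 2 ^ ν := by rw [← mul_pow]; norm_num
  rw [this]
  field_simp

lemma bil_eq_sum (F G : PowerSeries ℂ) {i j K : ℕ} (h : min i j < K) :
    bil F G i j
      = ∑ ν ∈ range K, coeff i (F * tanhSeries ^ ν) * coeff j (G * tanhSeries ^ ν) := by
  refine Finset.sum_subset (range_subset_range.2 h) fun ν _ hν => ?_
  have hν : min i j < ν := by
    rw [mem_range] at hν
    omega
  rcases min_lt_iff.1 hν with h | h
  · rw [coeff_mul_tanhSeries_pow_of_lt F h, zero_mul]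
  · rw [coeff_mul_tanhSeries_pow_of_lt G h, mul_zero]

lemma bil_comm (F G : PowerSeries ℂ) (i j : ℕ) : bil F G i j = bil G F j i := by
  rw [bil, bil, min_comm]
  exact Finset.sum_congr rfl fun _ _ => mul_comm _ _

lemma bil_add_left (F F' G : PowerSeries ℂ) (i j : ℕ) :
    bil (F + F') G i j = bil F G i j + bil F' G i j := by
  simp only [bil, add_mul, map_add, Finset.sum_add_distrib]

lemma bil_C_mul_left (c : ℂ) (F G : PowerSeries ℂ) (i j : ℕ) :
    bil (C c * F) G i j = c * bil F G i j := by
  simp only [bil, mul_assoc, coeff_C_mul, Finset.mul_sum]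

/-- With `p = e ^ X` and `q = e ^ Y`, the identity
`1 - tanh (X / 2) tanh (Y / 2) = 2 (p + q) / ((p + 1) (q + 1))` on the level of coefficients:
multiplication by `p + q` makes the kernel a product of a function of `X` and one of `Y`. -/
lemma bil_exp_mul_add (F G : PowerSeries ℂ) (i j : ℕ) :
    bil (PowerSeries.exp ℂ * F) G i j + bil F (PowerSeries.exp ℂ * G) i j
      = coeff i (C (1 / 2 : ℂ) * (PowerSeries.exp ℂ + 1) * F)
        * coeff j ((PowerSeries.exp ℂ + 1) * G) := by
  have hC : C (1 / 2 : ℂ) * 2 = 1 := by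
    rw [show (2 : PowerSeries ℂ) = C (2 : ℂ) from (map_ofNat C 2).symm, ← map_mul]; norm_num
  set p := PowerSeries.exp ℂ
  set τ := tanhSeries with hτ
  have ht : τ * (p + 1) = p - 1 := tanhSeries_mul
  set h := C (1 / 2 : ℂ)
  set a : ℕ → ℂ := fun ν => coeff i (h * (p + 1) * F * τ ^ ν) with ha
  set b : ℕ → ℂ := fun ν => coeff j (h * (p + 1) * G * τ ^ ν) with hb
  have key1 : ∀ (H : PowerSeries ℂ) (ν n : ℕ), coeff n (p * H * τ ^ ν)
      = coeff n (h * (p + 1) * H * τ ^ ν) + coeff n (h * (p + 1) * H * τ ^ (ν + 1)) := by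
    intro H ν n
    rw [← map_add]
    congr 1
    linear_combination (-(h * H * τ ^ ν)) * ht - (p * H * τ ^ ν) * hC
  have key2 : ∀ (H : PowerSeries ℂ) (ν n : ℕ), coeff n (H * τ ^ ν)
      = coeff n (h * (p + 1) * H * τ ^ ν) - coeff n (h * (p + 1) * H * τ ^ (ν + 1)) := by
    intro H ν n
    rw [← map_sub]
    congr 1
    linear_combination (h * H * τ ^ ν) * ht - (H * τ ^ ν) * hC
  rw [bil, bil, ← Finset.sum_add_distrib]
  have hterm : ∀ ν, coeff i (p * F * τ ^ ν) * coeff j (G * τ ^ ν)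
      + coeff i (F * τ ^ ν) * coeff j (p * G * τ ^ ν)
      = 2 * (a ν * b ν) - 2 * (a (ν + 1) * b (ν + 1)) := by
    intro ν
    rw [key1, key1, key2 F, key2 G]
    ring
  have hend : a (min i j + 1) * b (min i j + 1) = 0 := by
    rcases le_total i j with hij | hij
    · rw [show a (min i j + 1) = 0 from coeff_mul_tanhSeries_pow_of_lt _ (by omega), zero_mul]
    · rw [show b (min i j + 1) = 0 from coeff_mul_tanhSeries_pow_of_lt _ (by omega), mul_zero]
  rw [Finset.sum_congr rfl fun ν _ => hterm ν, Finset.sum_range_sub' (fun ν => 2 * (a ν * b ν)),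
    hend]
  have hb0 : coeff j ((p + 1) * G) = 2 * b 0 := by
    rw [hb]
    simp only [pow_zero, mul_one]
    rw [mul_assoc, coeff_C_mul]
    ring
  rw [hb0, ha]
  simp only [pow_zero, mul_one]
  ring

/-! ### Odd coefficients and multiplication by even series -/

/-- The matrix of the values of `bil F G` at the odd indices `1, 3, …, 2N - 1`. -/
def oddMat (N : ℕ) (F G : PowerSeries ℂ) : Matrix (Fin N) (Fin N) ℂ :=
  Matrix.of fun i j => bil F G (2 * (i : ℕ) + 1) (2 * (j : ℕ) + 1)

/-- The vector of the coefficients of `F` of odd degree `1, 3, …, 2N - 1`. -/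
def oddCoeff (N : ℕ) (F : PowerSeries ℂ) : Fin N → ℂ := fun i => coeff (2 * (i : ℕ) + 1) F

/-- The matrix of multiplication by an even series `f` on coefficients of odd degree. -/
def evenMul (N : ℕ) (f : PowerSeries ℂ) : Matrix (Fin N) (Fin N) ℂ :=
  Matrix.of fun i k => if (k : ℕ) ≤ i then coeff (2 * ((i : ℕ) - k)) f else 0

lemma oddDet_eq_det_oddMat (N : ℕ) (p q : ℕ → ℂ) :
    oddDet N p q = (oddMat N (schurSeries p) (schurSeries q)).det := by
  simp only [oddDet, oddMat, entry_eq_bil]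

lemma oddMat_transpose (N : ℕ) (F G : PowerSeries ℂ) :
    (oddMat N F G).transpose = oddMat N G F := by
  ext i j
  exact bil_comm _ _ _ _

lemma sum_range_two_mul (g : ℕ → ℂ) (n : ℕ) :
    ∑ m ∈ range (2 * n), g m = ∑ k ∈ range n, (g (2 * k) + g (2 * k + 1)) := by
  induction n with
  | zero => simp
  | succ n ih =>
    rw [Finset.sum_range_succ, ← ih, show 2 * (n + 1) = 2 * n + 1 + 1 by ring,
      Finset.sum_range_succ, Finset.sum_range_succ]
    ring

lemma oddCoeff_even_mul {N : ℕ} {f : PowerSeries ℂ} (hf : ∀ n, n % 2 = 1 → coeff n f = 0)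
    (F : PowerSeries ℂ) :
    oddCoeff N (f * F) = (evenMul N f).mulVec (oddCoeff N F) := by
  ext ⟨i, hi⟩
  simp only [oddCoeff, Matrix.mulVec, dotProduct, evenMul, Matrix.of_apply, ite_mul, zero_mul]
  rw [Fin.sum_univ_eq_sum_range
    (fun k => if k ≤ i then coeff (2 * (i - k)) f * coeff (2 * k + 1) F else 0) N,
    coeff_mul, Finset.Nat.sum_antidiagonal_eq_sum_range_succ (fun a b => coeff a f * coeff b F),
    show (2 * i + 1).succ = 2 * (i + 1) by omega, sum_range_two_mul]
  have h1 : ∀ k ∈ range (i + 1), coeff (2 * k) f * coeff (2 * i + 1 - 2 * k) F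
      + coeff (2 * k + 1) f * coeff (2 * i + 1 - (2 * k + 1)) F
      = coeff (2 * (i - (i + 1 - 1 - k))) f * coeff (2 * (i + 1 - 1 - k) + 1) F := by
    intro k hk
    have hk := mem_range.1 hk
    rw [hf (2 * k + 1) (by omega), zero_mul, add_zero]
    congr 3 <;> omega
  rw [Finset.sum_congr rfl h1,
    Finset.sum_range_reflect (fun k => coeff (2 * (i - k)) f * coeff (2 * k + 1) F)]
  refine (Finset.sum_congr rfl fun k hk => ?_).trans
    (Finset.sum_subset (range_subset_range.2 (show i + 1 ≤ N by omega)) fun k _ hk => ?_)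
  · rw [if_pos (by have := mem_range.1 hk; omega)]
  · rw [if_neg (by have : ¬ k < i + 1 := by simpa using hk
                   omega)]

lemma oddMat_even_mul_left {N : ℕ} {f : PowerSeries ℂ} (hf : ∀ n, n % 2 = 1 → coeff n f = 0)
    (F G : PowerSeries ℂ) :
    oddMat N (f * F) G = evenMul N f * oddMat N F G := by
  ext i j
  have hK : ∀ k : Fin N, min (2 * (k : ℕ) + 1) (2 * (j : ℕ) + 1) < 2 * (j : ℕ) + 2 := by
    intro k; omega
  rw [Matrix.mul_apply]
  simp only [oddMat, Matrix.of_apply]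
  simp only [fun H (k : Fin N) => bil_eq_sum H G (hK k), Finset.mul_sum]
  rw [Finset.sum_comm]
  refine Finset.sum_congr rfl fun ν _ => ?_
  have := congrFun (oddCoeff_even_mul (N := N) hf (F * tanhSeries ^ ν)) i
  simp only [oddCoeff, Matrix.mulVec, dotProduct] at this
  rw [mul_assoc f, this, Finset.sum_mul]
  exact Finset.sum_congr rfl fun k _ => by ring

lemma oddMat_even_mul_right {N : ℕ} {f : PowerSeries ℂ} (hf : ∀ n, n % 2 = 1 → coeff n f = 0)
    (F G : PowerSeries ℂ) :
    oddMat N F (f * G) = oddMat N F G * (evenMul N f).transpose := by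
  rw [← oddMat_transpose, oddMat_even_mul_left hf, Matrix.transpose_mul, oddMat_transpose]

lemma oddMat_add_left {N : ℕ} (F F' G : PowerSeries ℂ) :
    oddMat N (F + F') G = oddMat N F G + oddMat N F' G := by
  ext i j
  exact bil_add_left _ _ _ _ _

lemma oddMat_C_mul_left {N : ℕ} (c : ℂ) (F G : PowerSeries ℂ) :
    oddMat N (C c * F) G = c • oddMat N F G := by
  ext i j
  exact bil_C_mul_left _ _ _ _ _

lemma oddMat_add_right {N : ℕ} (F G G' : PowerSeries ℂ) :
    oddMat N F (G + G') = oddMat N F G + oddMat N F G' := by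
  rw [← oddMat_transpose, oddMat_add_left, Matrix.transpose_add, oddMat_transpose,
    oddMat_transpose]

lemma oddMat_C_mul_right {N : ℕ} (c : ℂ) (F G : PowerSeries ℂ) :
    oddMat N F (C c * G) = c • oddMat N F G := by
  rw [← oddMat_transpose, oddMat_C_mul_left, Matrix.transpose_smul, oddMat_transpose]

/-- The left vector in the rank-one identity for multiplication by `e ^ X + e ^ Y`. -/
def leftVec (N : ℕ) (F : PowerSeries ℂ) : Fin N → ℂ :=
  oddCoeff N (C (1 / 2 : ℂ) * (PowerSeries.exp ℂ + 1) * F)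

/-- The right vector in the rank-one identity for multiplication by `e ^ X + e ^ Y`. -/
def rightVec (N : ℕ) (G : PowerSeries ℂ) : Fin N → ℂ :=
  oddCoeff N ((PowerSeries.exp ℂ + 1) * G)

lemma oddMat_exp_mul_add (N : ℕ) (F G : PowerSeries ℂ) :
    oddMat N (PowerSeries.exp ℂ * F) G + oddMat N F (PowerSeries.exp ℂ * G)
      = Matrix.vecMulVec (leftVec N F) (rightVec N G) := by
  ext i j
  exact bil_exp_mul_add F G _ _

lemma exp_mul_expNeg_mul (F : PowerSeries ℂ) : PowerSeries.exp ℂ * (expNeg * F) = F := by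
  rw [← mul_assoc, exp_mul_expNeg, one_mul]

/-- The rank-one identity for multiplication by `e ^ (-X) + e ^ (-Y)`, which is
`e ^ (-X-Y) (e ^ X + e ^ Y)`. -/
lemma oddMat_expNeg_mul_add (N : ℕ) (F G : PowerSeries ℂ) :
    oddMat N (expNeg * F) G + oddMat N F (expNeg * G)
      = Matrix.vecMulVec (leftVec N (expNeg * F)) (rightVec N (expNeg * G)) := by
  rw [← oddMat_exp_mul_add, exp_mul_expNeg_mul, exp_mul_expNeg_mul, add_comm]

lemma oddMat_exp_mul_expNeg_mul (N : ℕ) (F G : PowerSeries ℂ) :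
    oddMat N (PowerSeries.exp ℂ * F) (expNeg * G)
      = Matrix.vecMulVec (leftVec N F) (rightVec N (expNeg * G)) - oddMat N F G := by
  rw [← oddMat_exp_mul_add, exp_mul_expNeg_mul, add_sub_cancel_right]

lemma oddMat_expNeg_mul_exp_mul (N : ℕ) (F G : PowerSeries ℂ) :
    oddMat N (expNeg * F) (PowerSeries.exp ℂ * G)
      = Matrix.vecMulVec (leftVec N (expNeg * F)) (rightVec N G) - oddMat N F G := by
  rw [← oddMat_exp_mul_add, exp_mul_expNeg_mul, add_sub_cancel_left]

/-- The matrix of multiplication by `2 cosh X = e ^ X + e ^ (-X)` on odd coefficients. -/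
def coshMat (N : ℕ) : Matrix (Fin N) (Fin N) ℂ := evenMul N (PowerSeries.exp ℂ + expNeg)

/-- The reduction: since `2 cosh X` is even, the operators `e ^ X + e ^ Y` and
`e ^ (-X) + e ^ (-Y)` differ on the odd coefficients by row and column operations only. -/
lemma coshMat_mul_oddMat_add (N : ℕ) (F G : PowerSeries ℂ) :
    coshMat N * oddMat N F G + oddMat N F G * (coshMat N).transpose
      = Matrix.vecMulVec (leftVec N F) (rightVec N G)
        + Matrix.vecMulVec (leftVec N (expNeg * F)) (rightVec N (expNeg * G)) := by
  have hf : ∀ n, n % 2 = 1 → coeff n (PowerSeries.exp ℂ + expNeg) = 0 :=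
    fun n hn => coeff_exp_add_expNeg_of_odd hn
  rw [coshMat, ← oddMat_even_mul_left hf, ← oddMat_even_mul_right hf, ← oddMat_exp_mul_add,
    ← oddMat_expNeg_mul_add, add_mul, add_mul, oddMat_add_left, oddMat_add_right]
  abel

lemma oddMat_sinh_mul_add (N : ℕ) (F G : PowerSeries ℂ) :
    oddMat N (expArg sinhVec * F) G + oddMat N F (expArg sinhVec * G)
      = (1 / 2 : ℂ) • (coshMat N * oddMat N F G + oddMat N F G * (coshMat N).transpose)
        - Matrix.vecMulVec (leftVec N (expNeg * F)) (rightVec N (expNeg * G)) := by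
  have hf : ∀ n, n % 2 = 1 → coeff n (PowerSeries.exp ℂ + expNeg) = 0 :=
    fun n hn => coeff_exp_add_expNeg_of_odd hn
  have e : ∀ H : PowerSeries ℂ, expArg sinhVec * H + expNeg * H
      = C (1 / 2 : ℂ) * ((PowerSeries.exp ℂ + expNeg) * H) := by
    intro H
    rw [expArg_sinhVec]
    ring
  have e1 := congrArg (fun H => oddMat N H G) (e F)
  have e2 := congrArg (fun H => oddMat N F H) (e G)
  simp only [oddMat_add_left, oddMat_add_right, oddMat_C_mul_left, oddMat_C_mul_right,
    oddMat_even_mul_left hf, oddMat_even_mul_right hf] at e1 e2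
  rw [← oddMat_expNeg_mul_add, eq_sub_iff_add_eq, smul_add, coshMat, ← e1, ← e2]
  abel

lemma oddCoeff_sinh_mul (N : ℕ) (F : PowerSeries ℂ) :
    oddCoeff N (expArg sinhVec * F)
      = (1 / 2 : ℂ) • (coshMat N).mulVec (oddCoeff N F) - oddCoeff N (expNeg * F) := by
  have hf : ∀ n, n % 2 = 1 → coeff n (PowerSeries.exp ℂ + expNeg) = 0 :=
    fun n hn => coeff_exp_add_expNeg_of_odd hn
  rw [coshMat, ← oddCoeff_even_mul hf, expArg_sinhVec]
  ext i
  simp only [oddCoeff, Pi.sub_apply, Pi.smul_apply, smul_eq_mul]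
  rw [← coeff_C_mul, ← map_sub]
  congr 1
  ring

lemma leftVec_sinh_mul (N : ℕ) (F : PowerSeries ℂ) :
    leftVec N (expArg sinhVec * F)
      = (1 / 2 : ℂ) • (coshMat N).mulVec (leftVec N F) - leftVec N (expNeg * F) := by
  simp only [leftVec]
  rw [mul_left_comm, oddCoeff_sinh_mul, mul_left_comm]

lemma rightVec_sinh_mul (N : ℕ) (G : PowerSeries ℂ) :
    rightVec N (expArg sinhVec * G)
      = (1 / 2 : ℂ) • (coshMat N).mulVec (rightVec N G) - rightVec N (expNeg * G) := by
  simp only [rightVec]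
  rw [mul_left_comm, oddCoeff_sinh_mul, mul_left_comm]

/-! ### Derivatives of determinants -/

section Calculus

open Matrix

variable {n : Type*} [Fintype n] [DecidableEq n]

/-- Jacobi's formula. -/
lemma hasDerivAt_det {M : ℝ → Matrix n n ℂ} {M' : Matrix n n ℂ} {x : ℝ}
    (hM : ∀ i j, HasDerivAt (fun y => M y i j) (M' i j) x) :
    HasDerivAt (fun y => (M y).det) (trace ((M x).adjugate * M')) x := by
  have h1 : HasDerivAt (fun y => (M y).det) (∑ σ : Equiv.Perm n,
      ((Equiv.Perm.sign σ : ℤ) : ℂ) *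
        ∑ i, (∏ j ∈ univ.erase i, M x (σ j) j) • M' (σ i) i) x := by
    simp only [det_apply']
    refine HasDerivAt.fun_sum fun σ _ => HasDerivAt.const_mul _ ?_
    exact HasDerivAt.fun_finsetProd fun i _ => hM (σ i) i
  have h2 : trace ((M x).adjugate * M') = ∑ σ : Equiv.Perm n,
      ((Equiv.Perm.sign σ : ℤ) : ℂ) *
        ∑ i, (∏ j ∈ univ.erase i, M x (σ j) j) • M' (σ i) i := by
    simp only [Finset.mul_sum]
    rw [Finset.sum_comm, trace]
    refine Finset.sum_congr rfl fun i _ => ?_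
    have : ((M x).adjugate * M').diag i = cramer (M x) (M'.col i) i := by
      rw [cramer_eq_adjugate_mulVec]
      rfl
    rw [this, cramer_apply, det_apply']
    refine Finset.sum_congr rfl fun σ _ => ?_
    rw [← Finset.mul_prod_erase univ _ (Finset.mem_univ i), updateCol_self, smul_eq_mul,
      mul_comm (M'.col i (σ i))]
    congr 2
    refine Finset.prod_congr rfl fun j hj => ?_
    rw [updateCol_ne (Finset.ne_of_mem_erase hj)]
  rw [h2]
  exact h1

lemma hasDerivAt_inv_mulVec {M : ℝ → Matrix n n ℂ} {M' : Matrix n n ℂ} {u : ℝ → n → ℂ}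
    {u' : n → ℂ} {x : ℝ} (hM : ∀ i j, HasDerivAt (fun y => M y i j) (M' i j) x)
    (hu : ∀ i, HasDerivAt (fun y => u y i) (u' i) x) (hdet : ∀ y, (M y).det ≠ 0) (i : n) :
    HasDerivAt (fun y => ((M y)⁻¹ *ᵥ u y) i)
      (((M x)⁻¹ *ᵥ (u' - M' *ᵥ ((M x)⁻¹ *ᵥ u x))) i) x := by
  have hdiff : ∀ i, DifferentiableAt ℝ (fun y => ((M y)⁻¹ *ᵥ u y) i) x := by
    intro i
    simp only [mulVec, dotProduct, Matrix.inv_def, Ring.inverse_eq_inv', Matrix.smul_apply,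
      smul_eq_mul]
    refine DifferentiableAt.fun_sum fun j _ => ?_
    refine DifferentiableAt.fun_mul (DifferentiableAt.fun_mul
      ((hasDerivAt_det hM).differentiableAt.fun_inv (hdet x)) ?_) (hu j).differentiableAt
    simp only [adjugate_apply]
    refine (hasDerivAt_det (M' := (M'.updateRow j 0)) fun a b => ?_).differentiableAt
    by_cases h : a = j
    · subst h
      simpa using hasDerivAt_const x ((Pi.single i 1 : n → ℂ) b)
    · simpa [updateRow_ne h] using hM a b
  -- the derivative is found by differentiating `M w = u`
  set w' : n → ℂ := fun i => deriv (fun y => ((M y)⁻¹ *ᵥ u y) i) x with hw'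
  have hunit : ∀ y, IsUnit (M y).det := fun y => isUnit_iff_ne_zero.2 (hdet y)
  have hsol : M' *ᵥ ((M x)⁻¹ *ᵥ u x) + M x *ᵥ w' = u' := by
    ext k
    have h1 : HasDerivAt (fun y => (M y *ᵥ ((M y)⁻¹ *ᵥ u y)) k)
        (∑ j, (M' k j * ((M x)⁻¹ *ᵥ u x) j + M x k j * w' j)) x :=
      HasDerivAt.fun_sum fun j _ => (hM k j).mul (hdiff j).hasDerivAt
    have h2 : (fun y => (M y *ᵥ ((M y)⁻¹ *ᵥ u y)) k) = fun y => u y k := by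
      ext y
      rw [mulVec_mulVec, mul_nonsing_inv _ (hunit y), one_mulVec]
    rw [h2] at h1
    rw [← h1.unique (hu k), Finset.sum_add_distrib]
    rfl
  have hw : w' = (M x)⁻¹ *ᵥ (u' - M' *ᵥ ((M x)⁻¹ *ᵥ u x)) := by
    rw [← hsol, add_sub_cancel_left, mulVec_mulVec, nonsing_inv_mul _ (hunit x), one_mulVec]
  rw [← hw]
  exact (hdiff i).hasDerivAt

lemma det_vecMulVec_sub {M : Matrix n n ℂ} (hM : M.det ≠ 0) (u v : n → ℂ) :
    (vecMulVec u v - M).det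
      = (-1) ^ Fintype.card n * M.det * (1 - v ⬝ᵥ (M⁻¹ *ᵥ u)) := by
  have h := det_add_replicateCol_mul_replicateRow (ι := Unit) (isUnit_iff_ne_zero.2 hM) (-u) v
  have e1 : vecMulVec u v - M = -(M + replicateCol Unit (-u) * replicateRow Unit v) := by
    ext i j
    simp [vecMulVec_apply, Matrix.mul_apply, sub_eq_add_neg]
  rw [e1, det_neg, h, mul_assoc]
  congr 2
  rw [det_unique, Matrix.add_apply, one_apply_eq, Matrix.mul_assoc, mul_apply]
  simp [dotProduct, mulVec, Matrix.mul_apply, sub_eq_add_neg]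

/-- If `M' = (L M + M Lᵀ) / 2 - a bᵀ`, where `L M + M Lᵀ = u vᵀ + a bᵀ`, then `det M` has the
logarithmic derivative `v ⬝ M⁻¹ u - tr L`. -/
lemma hasDerivAt_det_of_rank_one {M : ℝ → Matrix n n ℂ} {L : Matrix n n ℂ} {u v a b : ℝ → n → ℂ}
    {x : ℝ}
    (hM : ∀ i j, HasDerivAt (fun y => M y i j)
      (((1 / 2 : ℂ) • (L * M x + M x * Lᵀ) - vecMulVec (a x) (b x)) i j) x)
    (hL : L * M x + M x * Lᵀ = vecMulVec (u x) (v x) + vecMulVec (a x) (b x))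
    (hdet : (M x).det ≠ 0) :
    HasDerivAt (fun y => (M y).det)
      ((M x).det * (v x ⬝ᵥ ((M x)⁻¹ *ᵥ u x) - trace L)) x := by
  have hunit : IsUnit (M x).det := isUnit_iff_ne_zero.2 hdet
  have h := hasDerivAt_det hM
  convert h using 1
  have hadj : (M x).adjugate = (M x).det • (M x)⁻¹ := by
    rw [Matrix.inv_def, smul_smul, Ring.mul_inverse_cancel _ hunit, one_smul]
  have e : (1 / 2 : ℂ) • (L * M x + M x * Lᵀ) - vecMulVec (a x) (b x)
      = vecMulVec (u x) (v x) - (1 / 2 : ℂ) • (L * M x + M x * Lᵀ) := by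
    rw [sub_eq_sub_iff_add_eq_add, ← add_smul, hL]
    norm_num
  have t1 : trace ((M x)⁻¹ * (L * M x)) = trace L := by
    rw [trace_mul_comm, Matrix.mul_assoc, mul_nonsing_inv _ hunit, Matrix.mul_one]
  have t2 : trace ((M x)⁻¹ * (M x * Lᵀ)) = trace L := by
    rw [← Matrix.mul_assoc, nonsing_inv_mul _ hunit, Matrix.one_mul, trace_transpose]
  have t3 : trace ((M x)⁻¹ * vecMulVec (u x) (v x)) = v x ⬝ᵥ ((M x)⁻¹ *ᵥ u x) := by
    rw [mul_vecMulVec, trace_vecMulVec, dotProduct_comm]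
  rw [hadj, smul_mul, trace_smul, smul_eq_mul, e, Matrix.mul_sub, trace_sub, t3, Matrix.mul_smul,
    trace_smul, Matrix.mul_add, trace_add, t1, t2, smul_eq_mul]
  ring

/-- The second logarithmic derivative of the determinant factors: with `h = v ⬝ M⁻¹ u`,
`h' + 1 = (1 - v ⬝ M⁻¹ a) (1 - b ⬝ M⁻¹ u)`. -/
lemma hasDerivAt_dotProduct_inv_mulVec {M : ℝ → Matrix n n ℂ} {L : Matrix n n ℂ}
    {u v a b : ℝ → n → ℂ} {x : ℝ}
    (hM : ∀ i j, HasDerivAt (fun y => M y i j)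
      (((1 / 2 : ℂ) • (L * M x + M x * Lᵀ) - vecMulVec (a x) (b x)) i j) x)
    (hu : ∀ i, HasDerivAt (fun y => u y i) (((1 / 2 : ℂ) • L *ᵥ u x - a x) i) x)
    (hv : ∀ i, HasDerivAt (fun y => v y i) (((1 / 2 : ℂ) • L *ᵥ v x - b x) i) x)
    (hdet : ∀ y, (M y).det ≠ 0) :
    HasDerivAt (fun y => v y ⬝ᵥ ((M y)⁻¹ *ᵥ u y))
      ((1 - v x ⬝ᵥ ((M x)⁻¹ *ᵥ a x)) * (1 - b x ⬝ᵥ ((M x)⁻¹ *ᵥ u x)) - 1) x := by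
  have hunit : IsUnit (M x).det := isUnit_iff_ne_zero.2 (hdet x)
  have h : HasDerivAt (fun y => v y ⬝ᵥ ((M y)⁻¹ *ᵥ u y)) _ x :=
    HasDerivAt.fun_sum fun i _ => (hv i).mul (hasDerivAt_inv_mulVec hM hu hdet i)
  convert h using 1
  rw [Finset.sum_add_distrib]
  change _ = ((1 / 2 : ℂ) • L *ᵥ v x - b x) ⬝ᵥ ((M x)⁻¹ *ᵥ u x)
    + v x ⬝ᵥ ((M x)⁻¹ *ᵥ ((1 / 2 : ℂ) • L *ᵥ u x - a x
      - ((1 / 2 : ℂ) • (L * M x + M x * Lᵀ) - vecMulVec (a x) (b x)) *ᵥ ((M x)⁻¹ *ᵥ u x)))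
  set w := (M x)⁻¹ *ᵥ u x with hw
  have hMw : M x *ᵥ w = u x := by
    rw [hw, mulVec_mulVec, mul_nonsing_inv _ hunit, one_mulVec]
  have e1 : (M x)⁻¹ *ᵥ (M x *ᵥ (Lᵀ *ᵥ w)) = Lᵀ *ᵥ w := by
    rw [mulVec_mulVec, nonsing_inv_mul _ hunit, one_mulVec]
  have e2 : (L *ᵥ v x) ⬝ᵥ w = v x ⬝ᵥ (Lᵀ *ᵥ w) := by
    rw [dotProduct_mulVec (v x), vecMul_transpose]
  rw [sub_mulVec, smul_mulVec, add_mulVec, ← mulVec_mulVec, ← mulVec_mulVec, hMw,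
    vecMulVec_mulVec]
  simp only [mulVec_sub, mulVec_add, mulVec_smul, e1, sub_dotProduct, smul_dotProduct,
    dotProduct_sub, dotProduct_add, dotProduct_smul, e2, smul_eq_mul, op_smul_eq_smul]
  ring

end Calculus

/-! ### Dependence on the spatial variable -/

/-- The generating series of `S_j (x c + b)`, for `c` the Taylor coefficients of `sinh`. -/
def waveSeries (b : ℕ → ℂ) (x : ℝ) : PowerSeries ℂ :=
  schurSeries fun k => (x : ℂ) * sinhVec k + b k

lemma contDiff_coeff_waveSeries (b : ℕ → ℂ) (n : ℕ) :
    ContDiff ℝ ∞ fun x : ℝ => coeff n (waveSeries b x) := by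
  have hx : ContDiff ℝ ∞ fun x : ℝ => (x : ℂ) := Complex.ofRealCLM.contDiff
  induction n using Nat.strong_induction_on with
  | _ n ih =>
    cases n with
    | zero => simpa [waveSeries, constantCoeff_schurSeries] using contDiff_const
    | succ n =>
      simp only [waveSeries, coeff_succ_schurSeries, div_eq_mul_inv]
      refine ContDiff.mul (ContDiff.sum fun p hp => ?_) contDiff_const
      have hp := mem_antidiagonal.1 hp
      exact (ih p.1 (by omega)).mul (((hx.mul contDiff_const).add contDiff_const).mul
        contDiff_const)

lemma hasDerivAt_coeff_waveSeries (b : ℕ → ℂ) (n : ℕ) (x : ℝ) :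
    HasDerivAt (fun y : ℝ => coeff n (waveSeries b y))
      (coeff n (expArg sinhVec * waveSeries b x)) x := by
  induction n using Nat.strong_induction_on with
  | _ n ih =>
    cases n with
    | zero =>
      simpa [waveSeries, constantCoeff_schurSeries, constantCoeff_expArg]
        using hasDerivAt_const x (1 : ℂ)
    | succ n =>
      have hn : (n + 1 : ℂ) ≠ 0 := by exact_mod_cast n.succ_ne_zero
      have h1 : HasDerivAt (fun y : ℝ => coeff (n + 1) (waveSeries b y))
          ((∑ p ∈ antidiagonal n, (coeff p.1 (expArg sinhVec * waveSeries b x)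
              * (((x : ℂ) * sinhVec (p.2 + 1) + b (p.2 + 1)) * (p.2 + 1))
            + coeff p.1 (waveSeries b x) * (sinhVec (p.2 + 1) * (p.2 + 1)))) / (n + 1)) x := by
        simp only [waveSeries, coeff_succ_schurSeries]
        refine HasDerivAt.div_const (HasDerivAt.fun_sum fun p hp => ?_) _
        have hp := mem_antidiagonal.1 hp
        have h2 : HasDerivAt (fun y : ℝ => ((y : ℂ) * sinhVec (p.2 + 1) + b (p.2 + 1))
            * ((p.2 : ℂ) + 1)) (sinhVec (p.2 + 1) * (p.2 + 1)) x := by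
          simpa using (((hasDerivAt_id x).ofReal_comp.mul_const (sinhVec (p.2 + 1))).add_const
            (b (p.2 + 1))).mul_const ((p.2 : ℂ) + 1)
        exact (ih p.1 (by omega)).mul h2
      convert h1 using 1
      -- compare coefficients in `(c E)' = c' E + c E'`, where `E` is the generating series
      have h3 : coeff n (derivative ℂ (expArg sinhVec * waveSeries b x))
          = coeff n ((expArg sinhVec * waveSeries b x)
              * derivative ℂ (expArg fun k => (x : ℂ) * sinhVec k + b k)
            + waveSeries b x * derivative ℂ (expArg sinhVec)) := by
        rw [Derivation.leibniz, waveSeries, derivative_schurSeries]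
        simp only [smul_eq_mul]
        rw [mul_assoc]
      rw [coeff_derivative, map_add, coeff_mul n (_ * _), coeff_mul n (waveSeries b x),
        ← Finset.sum_add_distrib] at h3
      rw [eq_div_iff hn, h3]
      refine Finset.sum_congr rfl fun p _ => ?_
      rw [coeff_derivative, coeff_derivative]
      simp [expArg]

lemma hasDerivAt_coeff_mul_right {F : ℝ → PowerSeries ℂ} {F' : PowerSeries ℂ} {x : ℝ}
    (hF : ∀ n, HasDerivAt (fun y => coeff n (F y)) (coeff n F') x) (G : PowerSeries ℂ) (n : ℕ) :
    HasDerivAt (fun y => coeff n (F y * G)) (coeff n (F' * G)) x := by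
  simp only [coeff_mul]
  exact HasDerivAt.fun_sum fun p _ => (hF p.1).mul_const _

lemma hasDerivAt_oddMat (N : ℕ) (b c : ℕ → ℂ) (x : ℝ) (i j : Fin N) :
    HasDerivAt (fun y => oddMat N (waveSeries b y) (waveSeries c y) i j)
      ((oddMat N (expArg sinhVec * waveSeries b x) (waveSeries c x)
        + oddMat N (waveSeries b x) (expArg sinhVec * waveSeries c x)) i j) x := by
  simp only [oddMat, bil, Matrix.add_apply, Matrix.of_apply, ← Finset.sum_add_distrib]
  refine HasDerivAt.fun_sum fun ν _ => HasDerivAt.mul ?_ ?_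
  · exact hasDerivAt_coeff_mul_right (fun n => hasDerivAt_coeff_waveSeries b n x) _ _
  · exact hasDerivAt_coeff_mul_right (fun n => hasDerivAt_coeff_waveSeries c n x) _ _

lemma contDiff_det_oddMat (N : ℕ) (b c : ℕ → ℂ) :
    ContDiff ℝ ∞ fun x => (oddMat N (waveSeries b x) (waveSeries c x)).det := by
  simp only [Matrix.det_apply', oddMat, bil, Matrix.of_apply, coeff_mul]
  exact ContDiff.sum fun σ _ => contDiff_const.mul <| contDiff_prod fun i _ =>
    ContDiff.sum fun ν _ =>
      (ContDiff.sum fun p _ => (contDiff_coeff_waveSeries b _).mul contDiff_const).mul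
      (ContDiff.sum fun p _ => (contDiff_coeff_waveSeries c _).mul contDiff_const)

lemma hasDerivAt_leftVec (N : ℕ) (b : ℕ → ℂ) (x : ℝ) (i : Fin N) :
    HasDerivAt (fun y => leftVec N (waveSeries b y) i)
      (leftVec N (expArg sinhVec * waveSeries b x) i) x := by
  simp only [leftVec, oddCoeff, mul_comm (C (1 / 2 : ℂ) * (PowerSeries.exp ℂ + 1))]
  exact hasDerivAt_coeff_mul_right (fun n => hasDerivAt_coeff_waveSeries b n x) _ _

lemma hasDerivAt_rightVec (N : ℕ) (b : ℕ → ℂ) (x : ℝ) (i : Fin N) :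
    HasDerivAt (fun y => rightVec N (waveSeries b y) i)
      (rightVec N (expArg sinhVec * waveSeries b x) i) x := by
  simp only [rightVec, oddCoeff, mul_comm (PowerSeries.exp ℂ + 1)]
  exact hasDerivAt_coeff_mul_right (fun n => hasDerivAt_coeff_waveSeries b n x) _ _

/-! ### Complex conjugation and positivity -/

/-- Coefficientwise complex conjugation. -/
def conjSeries (F : PowerSeries ℂ) : PowerSeries ℂ := map (starRingEnd ℂ) F

lemma conjSeries_conjSeries (F : PowerSeries ℂ) : conjSeries (conjSeries F) = F := by
  ext n
  simp [conjSeries]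

lemma conjSeries_mul (F G : PowerSeries ℂ) :
    conjSeries (F * G) = conjSeries F * conjSeries G := map_mul _ _ _

lemma conjSeries_exp : conjSeries (PowerSeries.exp ℂ) = PowerSeries.exp ℂ := map_exp _

lemma conjSeries_expNeg : conjSeries expNeg = expNeg := by
  ext n
  simp [conjSeries, coeff_expNeg]

lemma conjSeries_tanhSeries : conjSeries tanhSeries = tanhSeries := by
  ext n
  simp [conjSeries, tanhSeries]

lemma conjSeries_waveSeries (b : ℕ → ℂ) (x : ℝ) :
    conjSeries (waveSeries b x) = waveSeries (fun k => starRingEnd ℂ (b k)) x := by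
  rw [conjSeries, waveSeries, map_conj_schurSeries, waveSeries]
  congr 1
  ext k
  simp [sinhVec, apply_ite (starRingEnd ℂ)]

lemma coeff_conjSeries_mul_tanhSeries_pow (F : PowerSeries ℂ) (n ν : ℕ) :
    coeff n (conjSeries F * tanhSeries ^ ν) = starRingEnd ℂ (coeff n (F * tanhSeries ^ ν)) := by
  conv_lhs => rw [← conjSeries_tanhSeries]
  rw [conjSeries, conjSeries, ← map_pow, ← map_mul, coeff_map]

lemma conj_det_oddMat (N : ℕ) (F G : PowerSeries ℂ) :
    starRingEnd ℂ (oddMat N F G).det = (oddMat N (conjSeries F) (conjSeries G)).det := by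
  rw [RingHom.map_det]
  congr 1
  ext i j
  simp [oddMat, bil, coeff_conjSeries_mul_tanhSeries_pow]

open scoped ComplexOrder in
/-- The matrix `oddMat N F F̄` is a Gram matrix `W Wᴴ`, and `W` has full row rank, since its columns
of odd index form a triangular matrix. -/
lemma det_oddMat_conj_pos (N : ℕ) {F : PowerSeries ℂ} (hF : constantCoeff F = 1) :
    0 < (oddMat N F (conjSeries F)).det := by
  set W : Matrix (Fin N) (Fin (2 * N)) ℂ :=
    Matrix.of fun i ν => coeff (2 * (i : ℕ) + 1) (F * tanhSeries ^ (ν : ℕ)) with hW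
  have hfac : oddMat N F (conjSeries F) = W * W.conjTranspose := by
    ext i j
    have hK : min (2 * (i : ℕ) + 1) (2 * (j : ℕ) + 1) < 2 * N := by omega
    rw [oddMat, Matrix.of_apply, bil_eq_sum _ _ hK, Matrix.mul_apply]
    rw [← Fin.sum_univ_eq_sum_range (fun ν => coeff (2 * (i : ℕ) + 1) (F * tanhSeries ^ ν)
      * coeff (2 * (j : ℕ) + 1) (conjSeries F * tanhSeries ^ ν))]
    refine Finset.sum_congr rfl fun ν _ => ?_
    rw [coeff_conjSeries_mul_tanhSeries_pow]
    rfl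
  set T : Matrix (Fin N) (Fin N) ℂ :=
    W.submatrix id (fun k => ⟨2 * (k : ℕ) + 1, by omega⟩) with hT
  have hTdet : T.det ≠ 0 := by
    have hdiag : ∀ n, coeff n (F * tanhSeries ^ n) ≠ 0 := by
      intro n
      have h1 : tanhSeries = X * (C (1 / 2 : ℂ) * schurSeries (fun k => (sCoeff k : ℂ))) := by
        rw [mul_left_comm, X_mul_schurSeries_sCoeff, ← mul_assoc, ← map_mul]
        simp
      have h2 := coeff_X_pow_mul
        (F * (C (1 / 2 : ℂ) * schurSeries (fun k => (sCoeff k : ℂ))) ^ n) n 0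
      rw [zero_add, mul_left_comm, ← mul_pow, ← h1] at h2
      rw [h2]
      simp [hF, constantCoeff_schurSeries]
    rw [Matrix.det_of_isLowerTriangular]
    · exact Finset.prod_ne_zero_iff.2 fun i _ => hdiag _
    · intro i j hij
      have hij : (i : ℕ) < j := hij
      exact coeff_mul_tanhSeries_pow_of_lt F (by change 2 * (i : ℕ) + 1 < 2 * (j : ℕ) + 1; omega)
  have hinj : Function.Injective W.vecMul := by
    intro c d hcd
    have hT' : Function.Injective T.vecMul :=
      Matrix.vecMul_injective_of_isUnit ((Matrix.isUnit_iff_isUnit_det T).2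
        (isUnit_iff_ne_zero.2 hTdet))
    refine hT' ?_
    ext k
    exact congrFun hcd ⟨2 * (k : ℕ) + 1, by omega⟩
  rw [hfac]
  exact (Matrix.PosDef.mul_conjTranspose_self W hinj).det_pos

/-! ### The bilinear identity -/

/-- The determinant `Δ_N (x c + b, x c + b̄)`, for `c` the Taylor coefficients of `sinh`. -/
def tau (N : ℕ) (b : ℕ → ℂ) (x : ℝ) : ℂ :=
  (oddMat N (waveSeries b x) (conjSeries (waveSeries b x))).det

/-- The determinant obtained from `tau` by adding `1` to the first variable on the left and
subtracting `1` from the first variable on the right. -/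
def tauShift (N : ℕ) (b : ℕ → ℂ) (x : ℝ) : ℂ :=
  (oddMat N (PowerSeries.exp ℂ * waveSeries b x) (expNeg * conjSeries (waveSeries b x))).det

open scoped ComplexOrder in
lemma tau_pos (N : ℕ) (b : ℕ → ℂ) (x : ℝ) : 0 < tau N b x :=
  det_oddMat_conj_pos N (constantCoeff_schurSeries _)

lemma tau_ne_zero (N : ℕ) (b : ℕ → ℂ) (x : ℝ) : tau N b x ≠ 0 := by
  open scoped ComplexOrder in exact (tau_pos N b x).ne'

lemma contDiff_tau (N : ℕ) (b : ℕ → ℂ) : ContDiff ℝ ∞ (tau N b) := by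
  have h : tau N b = fun x => (oddMat N (waveSeries b x)
      (waveSeries (fun k => starRingEnd ℂ (b k)) x)).det := by
    ext x
    rw [tau, conjSeries_waveSeries]
  rw [h]
  exact contDiff_det_oddMat N b _

lemma conj_tauShift (N : ℕ) (b : ℕ → ℂ) (x : ℝ) :
    starRingEnd ℂ (tauShift N b x)
      = (oddMat N (expNeg * waveSeries b x)
          (PowerSeries.exp ℂ * conjSeries (waveSeries b x))).det := by
  rw [tauShift, conj_det_oddMat, conjSeries_mul, conjSeries_mul, conjSeries_conjSeries,
    conjSeries_exp, conjSeries_expNeg, ← Matrix.det_transpose, oddMat_transpose]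

/-- The logarithmic derivative of `tau`. -/
def logDerivTau (N : ℕ) (b : ℕ → ℂ) (x : ℝ) : ℂ :=
  dotProduct (rightVec N (conjSeries (waveSeries b x)))
    ((oddMat N (waveSeries b x) (conjSeries (waveSeries b x)))⁻¹.mulVec
      (leftVec N (waveSeries b x))) - (coshMat N).trace

lemma hasDerivAt_oddMat_conj (N : ℕ) (b : ℕ → ℂ) (x : ℝ) (i j : Fin N) :
    HasDerivAt (fun y => oddMat N (waveSeries b y) (conjSeries (waveSeries b y)) i j)
      (((1 / 2 : ℂ) • (coshMat N * oddMat N (waveSeries b x) (conjSeries (waveSeries b x))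
          + oddMat N (waveSeries b x) (conjSeries (waveSeries b x)) * (coshMat N).transpose)
        - Matrix.vecMulVec (leftVec N (expNeg * waveSeries b x))
          (rightVec N (expNeg * conjSeries (waveSeries b x)))) i j) x := by
  rw [← oddMat_sinh_mul_add]
  simp only [conjSeries_waveSeries]
  exact hasDerivAt_oddMat N b _ x i j

lemma hasDerivAt_tau (N : ℕ) (b : ℕ → ℂ) (x : ℝ) :
    HasDerivAt (tau N b) (tau N b x * logDerivTau N b x) x :=
  hasDerivAt_det_of_rank_one (L := coshMat N)
    (u := fun y => leftVec N (waveSeries b y))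
    (v := fun y => rightVec N (conjSeries (waveSeries b y)))
    (a := fun y => leftVec N (expNeg * waveSeries b y))
    (b := fun y => rightVec N (expNeg * conjSeries (waveSeries b y)))
    (hasDerivAt_oddMat_conj N b x) (coshMat_mul_oddMat_add N _ _) (tau_ne_zero N b x)

/-- The second logarithmic derivative of `tau` is `|tauShift / tau| ^ 2 - 1`. -/
lemma hasDerivAt_logDerivTau (N : ℕ) (b : ℕ → ℂ) (x : ℝ) :
    HasDerivAt (logDerivTau N b)
      (tauShift N b x * starRingEnd ℂ (tauShift N b x) / tau N b x ^ 2 - 1) x := by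
  have hne := tau_ne_zero N b x
  have h := hasDerivAt_dotProduct_inv_mulVec (L := coshMat N) (x := x)
    (u := fun y => leftVec N (waveSeries b y))
    (v := fun y => rightVec N (conjSeries (waveSeries b y)))
    (a := fun y => leftVec N (expNeg * waveSeries b y))
    (b := fun y => rightVec N (expNeg * conjSeries (waveSeries b y)))
    (hasDerivAt_oddMat_conj N b x)
    (fun i => by
      rw [← leftVec_sinh_mul]
      exact hasDerivAt_leftVec N b x i)
    (fun i => by
      rw [← rightVec_sinh_mul]
      simp only [conjSeries_waveSeries]
      exact hasDerivAt_rightVec N _ x i)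
    (fun y => tau_ne_zero N b y)
  refine (h.sub_const (coshMat N).trace).congr_deriv ?_
  have hsq : ((-1 : ℂ) ^ N) * (-1) ^ N = 1 := by rw [← mul_pow]; simp
  rw [conj_tauShift, tauShift, oddMat_exp_mul_expNeg_mul, oddMat_expNeg_mul_exp_mul,
    det_vecMulVec_sub hne, det_vecMulVec_sub hne, Fintype.card_fin]
  change _ = _ * tau N b x * _ * (_ * tau N b x * _) / _ - _
  congr 1
  rw [eq_div_iff (pow_ne_zero 2 hne)]
  linear_combination -(tau N b x ^ 2
    * (1 - dotProduct (rightVec N (expNeg * conjSeries (waveSeries b x)))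
    ((oddMat N (waveSeries b x) (conjSeries (waveSeries b x)))⁻¹.mulVec
      (leftVec N (waveSeries b x)))) * (1 - dotProduct (rightVec N (conjSeries (waveSeries b x)))
    ((oddMat N (waveSeries b x) (conjSeries (waveSeries b x)))⁻¹.mulVec
      (leftVec N (expNeg * waveSeries b x))))) * hsq

/-- If `f' = f h`, then `D_x² f · f = 2 f² h'`. -/
lemma hirotaD_two_self {f h h' : ℝ → ℂ} (hf : ∀ x, HasDerivAt f (f x * h x) x)
    (hh : ∀ x, HasDerivAt h (h' x) x) (x : ℝ) :
    hirotaD 2 f f x = 2 * f x ^ 2 * h' x := by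
  have h1 : (hirotaOp fun ξ ξ' => f ξ * f ξ')
      = fun ξ ξ' => f ξ * h ξ * f ξ' - f ξ * (f ξ' * h ξ') := by
    ext ξ ξ'
    rw [hirotaOp, ((hf ξ).mul_const (f ξ')).deriv, ((hf ξ').const_mul (f ξ)).deriv]
  have h2 : ∀ y, HasDerivAt (fun z => f z * h z) (f y * h y * h y + f y * h' y) y :=
    fun y => (hf y).mul (hh y)
  rw [hirotaD, Function.iterate_succ_apply, Function.iterate_one, h1, hirotaOp,
    (((h2 x).mul_const (f x)).fun_sub ((hf x).mul_const (f x * h x))).deriv,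
    (((hf x).const_mul (f x * h x)).fun_sub ((h2 x).const_mul (f x))).deriv]
  ring

/-! ### The NLS and KPI determinants -/

/-- The part of the vector `x⁺(0) + a` that does not depend on `x`. -/
def nlsConst {N : ℕ} (a : Fin N → ℂ) (t : ℝ) (k : ℕ) : ℂ := nlsVec 1 0 0 t k + paramVec a k

lemma nlsVec_zero_add_paramVec {N : ℕ} (a : Fin N → ℂ) (x t : ℝ) (k : ℕ) :
    nlsVec 1 0 x t k + paramVec a k = x * sinhVec k + nlsConst a t k := by
  simp only [nlsVec, sinhVec, nlsConst]
  split_ifs with h1 h2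
  · simp
  · subst h2; simp; ring
  · simp; ring

lemma nlsVec_neg_one (n : ℤ) (x t : ℝ) (k : ℕ) :
    nlsVec (-1) n x t k = starRingEnd ℂ (nlsVec 1 (-n) x t k) := by
  simp only [nlsVec, apply_ite (starRingEnd ℂ)]
  have h2 : starRingEnd ℂ 2 = 2 := map_ofNat _ 2
  congr 2 <;> simp [h2]

lemma nlsVec_one (e : ℤ) (x t : ℝ) (k : ℕ) :
    nlsVec 1 e x t k = nlsVec 1 0 x t k + if k = 1 then (e : ℂ) else 0 := by
  simp only [nlsVec]
  split_ifs with h1 h2 <;> simp_all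

lemma schurSeries_nlsVec {N : ℕ} (a : Fin N → ℂ) (x t : ℝ) :
    schurSeries (fun k => nlsVec 1 0 x t k + paramVec a k) = waveSeries (nlsConst a t) x := by
  simp only [nlsVec_zero_add_paramVec]
  rfl

lemma schurSeries_nlsVec_int {N : ℕ} (n : ℤ) (a : Fin N → ℂ) (x t : ℝ) :
    schurSeries (fun k => nlsVec 1 n x t k + paramVec a k)
      = schurSeries (fun k => if k = 1 then (n : ℂ) else 0) * waveSeries (nlsConst a t) x := by
  rw [← schurSeries_nlsVec, ← schurSeries_add]
  congr 1
  ext k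
  rw [nlsVec_one n]
  ring

lemma schurSeries_nlsVec_neg {N : ℕ} (n : ℤ) (a : Fin N → ℂ) (x t : ℝ) :
    schurSeries (fun k => nlsVec (-1) n x t k + starRingEnd ℂ (paramVec a k))
      = conjSeries (schurSeries fun k => nlsVec 1 (-n) x t k + paramVec a k) := by
  rw [conjSeries, map_conj_schurSeries]
  simp only [nlsVec_neg_one, map_add]

lemma sigmaNLS_zero (N : ℕ) (a : Fin N → ℂ) (x t : ℝ) :
    sigmaNLS N 0 a x t = tau N (nlsConst a t) x := by
  rw [sigmaNLS, oddDet_eq_det_oddMat, schurSeries_nlsVec_neg, neg_zero, schurSeries_nlsVec, tau]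

lemma sigmaNLS_one (N : ℕ) (a : Fin N → ℂ) (x t : ℝ) :
    sigmaNLS N 1 a x t = tauShift N (nlsConst a t) x := by
  rw [sigmaNLS, oddDet_eq_det_oddMat, schurSeries_nlsVec_neg, schurSeries_nlsVec_int,
    schurSeries_nlsVec_int, conjSeries_mul, tauShift]
  simp only [Int.cast_one, Int.cast_neg]
  rw [schurSeries_single_one, schurSeries_single_neg_one, conjSeries_expNeg]

lemma entry_congr {p p' q q' : ℕ → ℂ} {i j : ℕ} (hp : ∀ k, 1 ≤ k → k ≤ i → p k = p' k)
    (hq : ∀ k, 1 ≤ k → k ≤ j → q k = q' k) : entry p q i j = entry p' q' i j := by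
  refine Finset.sum_congr rfl fun ν _ => ?_
  congr 1
  · congr 1
    exact schur_congr fun k h1 h2 => by rw [hp k h1 (by omega)]
  · exact schur_congr fun k h1 h2 => by rw [hq k h1 (by omega)]

/-- The KPI vector and the NLS vector with shifted parameters agree up to the index `2N - 1`, the
last one that enters the determinant. -/
lemma kpVec_add_paramVec {N : ℕ} (a : Fin N → ℂ) (x y t : ℝ) {k : ℕ} (hk : k < 2 * N) :
    kpVec x y t k + paramVec a k
      = nlsVec 1 0 x (2 * y) k + paramVec (shiftParam a t) k := by
  rcases Nat.mod_two_eq_zero_or_one k with h | h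
  · simp [kpVec, nlsVec, paramVec, h]
  · have h0 : ¬ k % 2 = 0 := by omega
    have h2 : k % 2 = 1 ∧ k / 2 < N := ⟨h, by omega⟩
    have h3 : 2 * (k / 2) + 1 = k := by omega
    simp only [kpVec, nlsVec, paramVec, shiftParam, dif_pos h2, if_neg h0, h3]
    by_cases h4 : k = 1
    · subst h4; simp; ring
    · obtain ⟨m, rfl⟩ : ∃ m, k = m + 1 := ⟨k - 1, by omega⟩
      rw [if_neg h4, Nat.add_sub_cancel]
      push_cast
      ring

lemma sigmaKP_eq_sigmaNLS (N : ℕ) (a : Fin N → ℂ) (x y t : ℝ) :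
    sigmaKP N a x y t = sigmaNLS N 0 (shiftParam a t) x (2 * y) := by
  refine congrArg Matrix.det (Matrix.ext fun i j => ?_)
  simp only [Matrix.of_apply]
  refine entry_congr (fun k _ hk => kpVec_add_paramVec a x y t (by omega)) fun k _ hk => ?_
  rw [← map_add, kpVec_add_paramVec a x y t (by omega), nlsVec_neg_one, map_add, neg_zero]

lemma tau_re_pos (N : ℕ) (b : ℕ → ℂ) (x : ℝ) :
    (tau N b x).im = 0 ∧ 0 < (tau N b x).re := by
  have h := Complex.lt_def.1 (tau_pos N b x)
  exact ⟨h.2.symm, h.1⟩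

lemma contDiff_log_tau (N : ℕ) (b : ℕ → ℂ) :
    ContDiff ℝ ∞ fun x => Complex.log (tau N b x) := by
  rw [contDiff_iff_contDiffAt]
  intro x
  have h : ContDiffAt ℝ ∞ Complex.log (tau N b x) :=
    (Complex.contDiffAt_log (n := ∞) (Or.inl (tau_re_pos N b x).2)).restrict_scalars ℝ
  exact h.comp x (contDiff_tau N b).contDiffAt

lemma iteratedDeriv_two_log_tau (N : ℕ) (b : ℕ → ℂ) (x : ℝ) :
    iteratedDeriv 2 (fun ξ => Complex.log (tau N b ξ)) x
      = tauShift N b x * starRingEnd ℂ (tauShift N b x) / tau N b x ^ 2 - 1 := by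
  have h1 : deriv (fun ξ => Complex.log (tau N b ξ)) = logDerivTau N b := by
    ext ξ
    rw [((hasDerivAt_tau N b ξ).clog_real (Or.inl (tau_re_pos N b ξ).2)).deriv,
      mul_div_cancel_left₀ _ (tau_ne_zero N b ξ)]
  rw [iteratedDeriv_succ, iteratedDeriv_one, h1, (hasDerivAt_logDerivTau N b x).deriv]

end

end RogueLump

theorem mainTheorem4 (N : ℕ) (hN : 1 ≤ N) (a : Fin N → ℂ) :
    -- the bilinear identity `(D_x² + 2) σ_0 · σ_0 = 2 |σ_1|²`
    (∀ x t : ℝ,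
      ContDiff ℝ ∞ (fun ξ : ℝ => RogueLump.sigmaNLS N 0 a ξ t) ∧
      RogueLump.hirotaD 2 (fun ξ : ℝ => RogueLump.sigmaNLS N 0 a ξ t)
          (fun ξ : ℝ => RogueLump.sigmaNLS N 0 a ξ t) x
        + 2 * (RogueLump.sigmaNLS N 0 a x t * RogueLump.sigmaNLS N 0 a x t)
        = ((2 * ‖RogueLump.sigmaNLS N 1 a x t‖ ^ 2 : ℝ) : ℂ)) ∧
    -- `σ_0` becomes `σ` under the substitution
    (∀ x y t : ℝ,
      RogueLump.sigmaKP N a x y t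
        = RogueLump.sigmaNLS N 0 (RogueLump.shiftParam a t) x (2 * y)) ∧
    -- both determinants are real and positive, and `ln σ` is smooth in `x`
    (∀ x t : ℝ, (RogueLump.sigmaNLS N 0 a x t).im = 0 ∧
      0 < (RogueLump.sigmaNLS N 0 a x t).re) ∧
    (∀ x y t : ℝ, (RogueLump.sigmaKP N a x y t).im = 0 ∧
      0 < (RogueLump.sigmaKP N a x y t).re) ∧
    (∀ y t : ℝ, ContDiff ℝ ∞ (fun ξ : ℝ => Complex.log (RogueLump.sigmaKP N a ξ y t))) ∧
    -- the transformation of solutions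
    (∀ x y t : ℝ,
      RogueLump.uKP N a x y t
        = ((2 * (‖RogueLump.uNLS N (RogueLump.shiftParam a t) x (2 * y)‖ ^ 2 - 1) : ℝ) : ℂ)) := by
  open RogueLump in
  refine ⟨fun x t => ⟨?_, ?_⟩, fun x y t => sigmaKP_eq_sigmaNLS N a x y t, fun x t => ?_,
    fun x y t => ?_, fun y t => ?_, fun x y t => ?_⟩
  · simp only [sigmaNLS_zero]
    exact contDiff_tau N _
  · simp only [sigmaNLS_zero, sigmaNLS_one]
    have hne := tau_ne_zero N (nlsConst a t) x
    rw [hirotaD_two_self (hasDerivAt_tau N (nlsConst a t)) (hasDerivAt_logDerivTau N _)]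
    push_cast
    rw [← Complex.mul_conj']
    field_simp
    ring
  · rw [sigmaNLS_zero]
    exact tau_re_pos N _ x
  · rw [sigmaKP_eq_sigmaNLS, sigmaNLS_zero]
    exact tau_re_pos N _ x
  · simp only [sigmaKP_eq_sigmaNLS, sigmaNLS_zero]
    exact contDiff_log_tau N _
  · simp only [uKP, uNLS, sigmaKP_eq_sigmaNLS, sigmaNLS_zero, sigmaNLS_one]
    rw [iteratedDeriv_two_log_tau]
    obtain ⟨him, hre⟩ := tau_re_pos N (nlsConst (shiftParam a t) (2 * y)) x
    set τ := tau N (nlsConst (shiftParam a t) (2 * y)) x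
    -- `τ` is real and positive, so `|τ|² = τ²`
    have hτ : ((‖τ‖ : ℂ)) ^ 2 = τ ^ 2 := by
      rw [← Complex.mul_conj', Complex.conj_eq_iff_im.2 him, sq]
    have hexp : ‖Complex.exp (Complex.I * ((2 * y : ℝ) : ℂ))‖ = 1 := by
      rw [mul_comm, Complex.norm_exp_ofReal_mul_I]
    rw [norm_mul, norm_div, hexp, mul_one, div_pow]
    push_cast
    rw [hτ, ← Complex.mul_conj']
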